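/- Let $\mathcal Y$ be a measurable space with a $\sigma$-finite measure $\mu$, and let $\{P_\theta\}_{\theta\in\Theta}$ be a family of probability measures on $\mathcal Y$ with fixed densities $f_\theta:\mathcal Y\to[0,\infty)$, $P_\theta(dy)=f_\theta(y)\,\mu(dy)$. For $n\ge 1$ and a collection $\Phi_n$ of probability measures on $\mathcal Y^n$ define the misspecified regret $$F_n(\Theta,\Phi_n)=\inf_q\ \sup_{P\in\Phi_n}\ \sup_{\theta\in\Theta}\ \mathbb E_{Y^n\sim P}\left[\log\frac{\prod_{t=1}^n f_\theta(Y_t)}{q(Y^n)}\right]\in[-\infty,+\infty],$$ where $\log\frac0c=-\infty$ and $\log\frac c0=+\infty$ for $c>0$, $\log\frac00=0$, and the infimum is over all admissible $q$, i.e. measurable $q:\mathcal Y^n\to[0,\infty)$ with $\int q\,d\mu^{\otimes n}=1$ for which the expectation is well defined (possibly infinite) for all $P\in\Phi_n$, $\theta\in\Theta$ (the infimum is $+\infty$ if there is no such $q$). For a set $\Phi$ of probability measures on $\mathcal Y$ let $\Phi^{\otimes n}=\{P^{\otimes n}:P\in\Phi\}$, let $C_n(\Phi)=\inf_{Q}\sup_{P\in\Phi}D(P^{\otimes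 n}\|Q)$, the infimum being over all probability measures $Q$ on $\mathcal Y^n$ and $D$ denoting Kullback–Leibler divergence, let $D(P\|\Theta)=\inf_{\theta\in\Theta}D(P\|P_\theta)$, and let $\Theta_\epsilon=\{P\in\Phi: D(P\|\Theta)\le\epsilon\}$. Suppose that (a) $P_\theta\in\Phi$ for every $\theta\in\Theta$, and $P\ll\mu$ for every $P\in\Phi$; (b) $C_n(\Phi)=\tau_n n$ for all $n\ge1$, where $\tau_n$ are real numbers with $\tau_n\to0$. Then for every sequence $\epsilon_n>0$ with $\epsilon_n\gg\tau_n$ (that is, $\tau_n/\epsilon_n\to0$) we have $$F_n(\Theta,\Phi^{\otimes n})\le F_n(\Theta,\Theta_{\epsilon_n}^{\otimes n})+o(1),\qquad n\to\infty.$$ -/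

import Mathlib

open MeasureTheory Filter Topology Asymptotics
open scoped ENNReal NNReal

noncomputable section

namespace MisspecifiedRegret

/-- The logarithm of the ratio `a / b` of two nonnegative reals, as an extended real, with the
conventions `log (0 / c) = -∞`, `log (c / 0) = +∞` for `c > 0`, and `log (0 / 0) = 0`. -/
def logRatio (a b : ℝ≥0) : EReal :=
  if a = 0 then (if b = 0 then 0 else ⊥)
  else if b = 0 then ⊤
  else ((Real.log ((a : ℝ) / (b : ℝ)) : ℝ) : EReal)

/-- The integral of the positive part of an extended real function. -/
def lintegralPos {Ω : Type*} [MeasurableSpace Ω] (ρ : Measure Ω) (X : Ω → EReal) : ℝ≥0∞ :=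
  ∫⁻ ω, (X ω).toENNReal ∂ρ

/-- The integral of the negative part of an extended real function. -/
def lintegralNeg {Ω : Type*} [MeasurableSpace Ω] (ρ : Measure Ω) (X : Ω → EReal) : ℝ≥0∞ :=
  ∫⁻ ω, (-X ω).toENNReal ∂ρ

/-- The expectation of `X` is well defined (possibly infinite): it is not of the form `∞ - ∞`. -/
def ExpectationDefined {Ω : Type*} [MeasurableSpace Ω] (ρ : Measure Ω) (X : Ω → EReal) : Prop :=
  lintegralPos ρ X ≠ ⊤ ∨ lintegralNeg ρ X ≠ ⊤

/-- The expectation of `X`, used only when `ExpectationDefined ρ X` holds. -/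
def expectation {Ω : Type*} [MeasurableSpace Ω] (ρ : Measure Ω) (X : Ω → EReal) : EReal :=
  (lintegralPos ρ X : EReal) - (lintegralNeg ρ X : EReal)

variable {Y : Type*} [MeasurableSpace Y] {Θ : Type*}

/-- The log-likelihood ratio `log (∏ₜ f_θ(yₜ) / q(yⁿ))`. -/
def logLikelihoodRatio (f : Θ → Y → ℝ≥0) (n : ℕ) (q : (Fin n → Y) → ℝ≥0) (θ : Θ)
    (y : Fin n → Y) : EReal :=
  logRatio (∏ t, f θ (y t)) (q y)

/-- `q` is an admissible density on `Yⁿ` relative to `μ^{⊗n}`: measurable, of total integral one,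
and such that the expected log-likelihood ratio is well defined for all `P ∈ Φn` and all `θ`. -/
structure Admissible (f : Θ → Y → ℝ≥0) (μ : Measure Y) (n : ℕ)
    (Φn : Set (ProbabilityMeasure (Fin n → Y))) (q : (Fin n → Y) → ℝ≥0) : Prop where
  measurable : Measurable q
  lintegral_eq_one : ∫⁻ y, (q y : ℝ≥0∞) ∂(Measure.pi fun _ : Fin n => μ) = 1
  defined : ∀ P ∈ Φn, ∀ θ, ExpectationDefined (P : Measure (Fin n → Y)) (logLikelihoodRatio f n q θ)

/-- The misspecified regret `F_n(Θ, Φn)`: the infimum over admissible densities `q` of the supremum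
over `P ∈ Φn` and `θ ∈ Θ` of `E_P [log (∏ₜ f_θ(Yₜ) / q(Yⁿ))]`; it is `+∞` if no density is
admissible. -/
def regret (f : Θ → Y → ℝ≥0) (μ : Measure Y) (n : ℕ)
    (Φn : Set (ProbabilityMeasure (Fin n → Y))) : EReal :=
  ⨅ (q : (Fin n → Y) → ℝ≥0) (_ : Admissible f μ n Φn q),
    ⨆ P ∈ Φn, ⨆ θ : Θ, expectation (P : Measure (Fin n → Y)) (logLikelihoodRatio f n q θ)

/-- The `n`-fold product `P^{⊗n}`. -/
def iidPower (n : ℕ) (P : ProbabilityMeasure Y) : ProbabilityMeasure (Fin n → Y) :=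
  ProbabilityMeasure.pi fun _ : Fin n => P

/-- `Φ^{⊗n} = {P^{⊗n} : P ∈ Φ}`. -/
def iidClass (n : ℕ) (Φ : Set (ProbabilityMeasure Y)) : Set (ProbabilityMeasure (Fin n → Y)) :=
  iidPower n '' Φ

/-- The capacity `C_n(Φ) = inf_Q sup_{P ∈ Φ} D(P^{⊗n} ‖ Q)`, with `Q` ranging over all probability
measures on `Yⁿ`. -/
def capacity (Φ : Set (ProbabilityMeasure Y)) (n : ℕ) : ℝ≥0∞ :=
  ⨅ Q : ProbabilityMeasure (Fin n → Y), ⨆ P ∈ Φ,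
    InformationTheory.klDiv (iidPower n P : Measure (Fin n → Y)) (Q : Measure (Fin n → Y))

/-- `D(P ‖ Θ) = inf_θ D(P ‖ P_θ)`. -/
def divergenceToModel (Pm : Θ → ProbabilityMeasure Y) (P : ProbabilityMeasure Y) : ℝ≥0∞ :=
  ⨅ θ : Θ, InformationTheory.klDiv (P : Measure Y) (Pm θ : Measure Y)

/-- `Θ_ε = {P ∈ Φ : D(P ‖ Θ) ≤ ε}`. -/
def enlargedModel (Pm : Θ → ProbabilityMeasure Y) (Φ : Set (ProbabilityMeasure Y)) (ε : ℝ) :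
    Set (ProbabilityMeasure Y) :=
  {P | P ∈ Φ ∧ divergenceToModel Pm P ≤ ENNReal.ofReal ε}

end MisspecifiedRegret

end

namespace MisspecifiedRegret

open InformationTheory ProbabilityTheory

/-! Take `q` admissible for the enlarged model and `Q` with `D(P^n ‖ Q) ≤ K = nτ_n + 1` on all of
`Φ`, and mix them, giving the density of `Q` weight `e^{-c}`. Near the model, the mixture dominates
`(1 - e^{-c}) q`, which costs only `O(-log(1 - e^{-c}))`. Away from it, where `D(P ‖ Θ) > ε`, the
mixture dominates `e^{-c} dQ`, and the regret is at most `D(P^n ‖ Q) + c - D(P^n ‖ P_θ^n) ≤ K + c -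
nε`. This is harmless once it is nonpositive, because the regret of `q` is nonnegative: the enlarged
model contains every `P_θ`, so Gibbs' inequality applies (`expectation_logRatio_nonneg`). It remains
to let `c → ∞` while `K + c ≤ nε`, which requires `n(ε_n - τ_n) → ∞`. Since `ε_n ≫ τ_n`, a positive
lower bound on the capacity `nτ_n` suffices; it holds as soon as `Φ` has two members
(`exists_pos_le_capacity`), and otherwise the two classes coincide. The two regimes are
`expectation_logRatio_le_add` and `expectation_logRatio_le_of_klDiv`; they are joined in
`regret_le_regret_enlargedModel_add`. -/

/-! ### Product measures and divergence of powers -/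

lemma lintegral_pi_prod {Y : Type*} [MeasurableSpace Y] :
    ∀ (n : ℕ) (μ : Fin n → Measure Y) [∀ i, SigmaFinite (μ i)] (g : Fin n → Y → ℝ≥0∞)
      (_ : ∀ i, Measurable (g i)),
      ∫⁻ y, ∏ i, g i (y i) ∂(Measure.pi μ) = ∏ i, ∫⁻ y, g i y ∂(μ i)
  | 0, μ, _, g, _ => by simp
  | n + 1, μ, _, g, hg => by
    have h := (measurePreserving_piFinSuccAbove μ 0).symm
    rw [← h.lintegral_comp_emb (MeasurableEquiv.measurableEmbedding _)]
    simp only [Fin.prod_univ_succ, MeasurableEquiv.piFinSuccAbove_symm_apply,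
      Fin.insertNthEquiv, Equiv.coe_fn_mk, Fin.insertNth_zero, Fin.cons_zero, Fin.cons_succ,
      Fin.zero_succAbove, cast_eq]
    rw [lintegral_prod_mul (f := g 0) (g := fun y : Fin n → Y => ∏ i : Fin n, g i.succ (y i))
      (hg 0).aemeasurable (Finset.measurable_fun_prod _ fun i _ =>
        (hg i.succ).comp (measurable_pi_apply i)).aemeasurable, lintegral_pi_prod n _ (fun i => g i.succ) fun i => hg _]

lemma pi_withDensity {Y : Type*} [MeasurableSpace Y] (n : ℕ) (μ : Measure Y) [SigmaFinite μ]
    (g : Y → ℝ≥0∞) (hg : Measurable g) [SigmaFinite (μ.withDensity g)] :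
    Measure.pi (fun _ : Fin n => μ.withDensity g) =
      (Measure.pi fun _ : Fin n => μ).withDensity fun y => ∏ i, g (y i) := by
  symm
  refine (Measure.pi_eq fun s hs => ?_).symm
  rw [withDensity_apply _ (MeasurableSet.univ_pi hs), Measure.restrict_pi_pi,
    lintegral_pi_prod n _ (fun _ => g) fun _ => hg]
  exact Finset.prod_congr rfl fun i _ => (withDensity_apply _ (hs i)).symm

lemma pi_absolutelyContinuous {Y : Type*} [MeasurableSpace Y] (n : ℕ) {P μ : Measure Y}
    [SigmaFinite μ] [IsFiniteMeasure P] (h : P ≪ μ) :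
    Measure.pi (fun _ : Fin n => P) ≪ Measure.pi fun _ : Fin n => μ := by
  have hP := Measure.withDensity_rnDeriv_eq P μ h
  have : SigmaFinite (μ.withDensity (P.rnDeriv μ)) := by rw [hP]; infer_instance
  have h2 := pi_withDensity n μ _ (Measure.measurable_rnDeriv P μ)
  rw [hP] at h2
  rw [h2]
  exact withDensity_absolutelyContinuous _ _

/-- Split off one coordinate by the chain rule; projecting the conditional term to the remaining
coordinates can only decrease it. Equality is not needed. -/
lemma nsmul_klDiv_le_klDiv_pi {Y : Type*} [MeasurableSpace Y] (P R : Measure Y)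
    [IsProbabilityMeasure P] [IsProbabilityMeasure R] :
    ∀ n : ℕ, (n : ℝ≥0∞) * klDiv P R ≤
      klDiv (Measure.pi fun _ : Fin n => P) (Measure.pi fun _ : Fin n => R)
  | 0 => by simp
  | n + 1 => by
    have hP := measurePreserving_piFinSuccAbove (fun _ : Fin (n + 1) => P) 0
    have hR := measurePreserving_piFinSuccAbove (fun _ : Fin (n + 1) => R) 0
    have h1 := klDiv_map_le (Measure.pi fun _ : Fin (n + 1) => P)
      (Measure.pi fun _ : Fin (n + 1) => R) hP.measurable
    rw [hP.map_eq, hR.map_eq] at h1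
    refine le_trans ?_ h1
    rw [← Measure.compProd_const, ← Measure.compProd_const, klDiv_compProd_eq_add,
      Measure.compProd_const, Measure.compProd_const]
    have h2 := klDiv_map_le (P.prod (Measure.pi fun _ : Fin n => P))
      (P.prod (Measure.pi fun _ : Fin n => R)) measurable_snd
    have e1 := Measure.snd_prod (μ := P) (ν := Measure.pi fun _ : Fin n => P)
    have e2 := Measure.snd_prod (μ := P) (ν := Measure.pi fun _ : Fin n => R)
    rw [Measure.snd] at e1 e2
    rw [e1, e2] at h2
    calc ((n + 1 : ℕ) : ℝ≥0∞) * klDiv P R = klDiv P R + n * klDiv P R := by push_cast; ring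
      _ ≤ _ := add_le_add le_rfl ((nsmul_klDiv_le_klDiv_pi P R n).trans h2)

/-! ### A weak Pinsker bound and positivity of the capacity -/

lemma sq_le_klDiv {Y : Type*} [MeasurableSpace Y] (P Q : Measure Y)
    [IsProbabilityMeasure P] [IsProbabilityMeasure Q] {A : Set Y} (hA : MeasurableSet A) :
    ENNReal.ofReal ((P.real A - Q.real A) ^ 2 / 4) ≤ klDiv P Q := by
  by_cases htop : klDiv P Q = ⊤
  · simp [htop]
  obtain ⟨hac, hint⟩ := klDiv_ne_top_iff.1 htop
  refine ENNReal.ofReal_le_of_le_toReal ?_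
  rw [toReal_klDiv_eq_integral_klFun hac]
  set t : ℝ := (P.real A - Q.real A) / 2 with ht
  have hP0 : 0 ≤ P.real A := measureReal_nonneg
  have hP1 : P.real A ≤ 1 := measureReal_le_one
  have hQ0 : 0 ≤ Q.real A := measureReal_nonneg
  have hQ1 : Q.real A ≤ 1 := measureReal_le_one
  have hexp : Real.exp t - 1 ≤ t + t ^ 2 := by
    have := Real.abs_exp_sub_one_sub_id_le (x := t) (by rw [abs_le]; constructor <;> linarith)
    linarith [le_abs_self (Real.exp t - 1 - t)]
  -- Young's inequality for `klFun` and its convex conjugate. It is integrated over `A` with `s =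
  -- t`; off `A` only `klFun ≥ 0` is used. The choice of `t` maximizes `t (P A - Q A) - t²`.
  have hyoung (x s : ℝ) (hx : 0 ≤ x) : s * x - (Real.exp s - 1) ≤ klFun x := by
    rw [klFun_apply]
    rcases hx.eq_or_lt with rfl | hx
    · simp; positivity
    · have h1 := Real.add_one_le_exp (s - Real.log x)
      rw [Real.exp_sub, Real.exp_log hx, le_div_iff₀ hx] at h1
      linarith
  have hi : Integrable (fun y => (P.rnDeriv Q y).toReal) Q := Measure.integrable_toReal_rnDeriv
  have hlow : ∫ y in A, (t * (P.rnDeriv Q y).toReal - (Real.exp t - 1)) ∂Q ≤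
      ∫ y, klFun (P.rnDeriv Q y).toReal ∂Q := by
    rw [← integral_indicator hA]
    refine integral_mono ?_ ((integrable_klFun_rnDeriv_iff hac).2 hint) fun y => ?_
    · exact ((hi.const_mul t).sub (integrable_const _)).indicator hA
    · by_cases hy : y ∈ A
      · simpa [hy] using hyoung _ t ENNReal.toReal_nonneg
      · simpa [hy] using klFun_nonneg ENNReal.toReal_nonneg
  refine le_trans ?_ hlow
  rw [integral_sub (hi.const_mul t).integrableOn (integrable_const _), integral_const_mul,
    Measure.setIntegral_toReal_rnDeriv hac]
  simp only [integral_const, measureReal_restrict_apply_univ, smul_eq_mul]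
  have h3 : Q.real A * (Real.exp t - 1) ≤ Q.real A * t + t ^ 2 := by
    nlinarith [mul_le_mul_of_nonneg_left hexp hQ0, sq_nonneg t]
  have : t * P.real A - Q.real A * t - t ^ 2 = (P.real A - Q.real A) ^ 2 / 4 := by rw [ht]; ring
  linarith

/-- A one-coordinate marginal of `Q` cannot be close to both `P` and `P'` on a set `A` that
separates them: it misses one of the two values by at least half their gap. Data processing makes
the bound uniform in `n`. -/
lemma exists_pos_le_capacity {Y : Type*} [MeasurableSpace Y] {Φ : Set (ProbabilityMeasure Y)}
    {P P' : ProbabilityMeasure Y} (hP : P ∈ Φ) (hP' : P' ∈ Φ) (hne : P ≠ P') :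
    ∃ c : ℝ, 0 < c ∧ ∀ n : ℕ, 1 ≤ n → ENNReal.ofReal c ≤ capacity Φ n := by
  have hne' : (P : Measure Y) ≠ P' := fun h => hne (Subtype.ext h)
  obtain ⟨A, hA, hAne⟩ : ∃ A, MeasurableSet A ∧ (P : Measure Y).real A ≠ (P' : Measure Y).real A := by
    by_contra! h
    exact hne' (Measure.ext fun A hA => (measureReal_eq_measureReal_iff).1 (h A hA))
  set a := (P : Measure Y).real A
  set a' := (P' : Measure Y).real A
  have hpos : 0 < (a - a') ^ 2 := by have := sub_ne_zero.2 hAne; positivity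
  refine ⟨(a - a') ^ 2 / 16, by positivity, fun n hn => le_iInf fun Q => ?_⟩
  set Q' := (Q : Measure (Fin n → Y)).map (Function.eval (⟨0, hn⟩ : Fin n)) with hQ'
  have : IsProbabilityMeasure Q' :=
    Measure.isProbabilityMeasure_map (measurable_pi_apply _).aemeasurable
  have key (R : ProbabilityMeasure Y) (hR : R ∈ Φ) :
      ENNReal.ofReal (((R : Measure Y).real A - Q'.real A) ^ 2 / 4) ≤
      ⨆ P ∈ Φ, klDiv (iidPower n P : Measure (Fin n → Y)) (Q : Measure (Fin n → Y)) := by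
    refine le_trans ?_ (le_iSup₂ (f := fun (P : ProbabilityMeasure Y) (_ : P ∈ Φ) =>
      klDiv (iidPower n P : Measure (Fin n → Y)) (Q : Measure (Fin n → Y))) R hR)
    refine (sq_le_klDiv (R : Measure Y) Q' hA).trans ?_
    have h := klDiv_map_le (iidPower n R : Measure (Fin n → Y)) (Q : Measure (Fin n → Y))
      (measurable_pi_apply (⟨0, hn⟩ : Fin n))
    have e : (iidPower n R : Measure (Fin n → Y)).map (Function.eval (⟨0, hn⟩ : Fin n)) = R :=
      (measurePreserving_eval (fun _ : Fin n => (R : Measure Y)) _).map_eq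
    rwa [show (fun y : Fin n → Y => y ⟨0, hn⟩) = Function.eval (⟨0, hn⟩ : Fin n) from rfl, e] at h
  set b := Q'.real A
  have h12 : (a - a') ^ 2 / 16 ≤ (a - b) ^ 2 / 4 ∨ (a - a') ^ 2 / 16 ≤ (a' - b) ^ 2 / 4 := by
    by_contra! h
    nlinarith [sq_nonneg (a - b + (a' - b))]
  rcases h12 with h | h
  · exact (ENNReal.ofReal_le_ofReal h).trans (key P hP)
  · exact (ENNReal.ofReal_le_ofReal h).trans (key P' hP')

/-! ### Extended real expectations of log-ratios -/

lemma toENNReal_coe_real (x : ℝ) : ((x : ℝ) : EReal).toENNReal = ENNReal.ofReal x := by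
  rw [EReal.toENNReal_of_ne_top (EReal.coe_ne_top _), EReal.toReal_coe]

lemma logRatio_of_pos {a b : ℝ≥0} (ha : a ≠ 0) (hb : b ≠ 0) :
    logRatio a b = ((Real.log a - Real.log b : ℝ) : EReal) := by
  rw [logRatio, if_neg ha, if_neg hb, Real.log_div (by simpa using ha) (by simpa using hb)]

lemma measurable_logRatio {Ω : Type*} [MeasurableSpace Ω] {a b : Ω → ℝ≥0} (ha : Measurable a)
    (hb : Measurable b) : Measurable fun ω => logRatio (a ω) (b ω) := by
  unfold logRatio
  refine Measurable.ite (ha (measurableSet_singleton 0))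
    (Measurable.ite (hb (measurableSet_singleton 0)) measurable_const measurable_const)
    (Measurable.ite (hb (measurableSet_singleton 0)) measurable_const ?_)
  fun_prop

/-- If `b' ≥ e^{-c} b`, the expected log-ratio increases by at most `2 c`. -/
lemma expectation_logRatio_le_add {Ω : Type*} [MeasurableSpace Ω] (ρ : Measure Ω)
    [IsProbabilityMeasure ρ] (r q q' : Ω → ℝ≥0) {c : ℝ} (hc : 0 ≤ c)
    (h : ∀ ω, Real.exp (-c) * q ω ≤ q' ω) :
    expectation ρ (fun ω => logRatio (r ω) (q' ω)) ≤
      expectation ρ (fun ω => logRatio (r ω) (q ω)) + ((2 * c : ℝ) : EReal) := by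
  have hq' (ω) (h0 : q ω ≠ 0) : q' ω ≠ 0 := by
    have h1 : (0 : ℝ) < q ω := by exact_mod_cast pos_iff_ne_zero.2 h0
    have h2 : (0 : ℝ) < q' ω := lt_of_lt_of_le (by positivity) (h ω)
    exact_mod_cast h2.ne'
  have hlog (ω) (h0 : q ω ≠ 0) : Real.log (q ω) - c ≤ Real.log (q' ω) := by
    have h1 : (0 : ℝ) < q ω := by exact_mod_cast pos_iff_ne_zero.2 h0
    have := Real.log_le_log (by positivity) (h ω)
    rw [Real.log_mul (by positivity) h1.ne', Real.log_exp] at this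
    linarith
  -- Positive and negative parts are compared separately, each at a cost of `c`; hence the total `2
  -- * c`.
  have hpos : lintegralPos ρ (fun ω => logRatio (r ω) (q' ω)) ≤
      lintegralPos ρ (fun ω => logRatio (r ω) (q ω)) + ENNReal.ofReal c := by
    have : ENNReal.ofReal c = ∫⁻ _, ENNReal.ofReal c ∂ρ := by simp
    rw [lintegralPos, lintegralPos, this, ← lintegral_add_right _ measurable_const]
    refine lintegral_mono fun ω => ?_
    by_cases hr : r ω = 0
    · by_cases h' : q' ω = 0 <;> simp [logRatio, hr, h']
    by_cases h0 : q ω = 0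
    · simp [logRatio, hr, h0]
    dsimp only
    rw [logRatio_of_pos hr h0, logRatio_of_pos hr (hq' ω h0), toENNReal_coe_real,
      toENNReal_coe_real]
    refine (ENNReal.ofReal_le_ofReal ?_).trans ENNReal.ofReal_add_le
    linarith [hlog ω h0]
  have hneg : lintegralNeg ρ (fun ω => logRatio (r ω) (q ω)) ≤
      lintegralNeg ρ (fun ω => logRatio (r ω) (q' ω)) + ENNReal.ofReal c := by
    have : ENNReal.ofReal c = ∫⁻ _, ENNReal.ofReal c ∂ρ := by simp
    rw [lintegralNeg, lintegralNeg, this, ← lintegral_add_right _ measurable_const]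
    refine lintegral_mono fun ω => ?_
    by_cases hr : r ω = 0
    · by_cases h0 : q ω = 0
      · simp [logRatio, hr, h0]
      · simp [logRatio, hr, hq' ω h0]
    by_cases h0 : q ω = 0
    · simp [logRatio, hr, h0]
    dsimp only
    rw [logRatio_of_pos hr h0, logRatio_of_pos hr (hq' ω h0), ← EReal.coe_neg, ← EReal.coe_neg,
      toENNReal_coe_real, toENNReal_coe_real]
    refine (ENNReal.ofReal_le_ofReal ?_).trans ENNReal.ofReal_add_le
    linarith [hlog ω h0]
  unfold expectation
  generalize lintegralPos ρ (fun ω => logRatio (r ω) (q' ω)) = p' at *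
  generalize lintegralPos ρ (fun ω => logRatio (r ω) (q ω)) = p at *
  generalize lintegralNeg ρ (fun ω => logRatio (r ω) (q' ω)) = m' at *
  generalize lintegralNeg ρ (fun ω => logRatio (r ω) (q ω)) = m at *
  by_cases hm' : m' = ⊤
  · simp [hm']
  have hm : m ≠ ⊤ := ne_top_of_le_ne_top (by finiteness) hneg
  lift m' to ℝ≥0 using hm'
  lift m to ℝ≥0 using hm
  by_cases hp : p = ⊤
  · rw [hp, EReal.coe_ennreal_top]
    have e1 : (⊤ : EReal) - ((m : ℝ≥0∞) : EReal) = ⊤ := by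
      rw [show (((m : ℝ≥0∞) : EReal)) = ((m : ℝ) : EReal) from rfl]
      exact EReal.top_sub_coe _
    rw [e1, EReal.top_add_coe]
    exact le_top
  have hp' : p' ≠ ⊤ := ne_top_of_le_ne_top (by finiteness) hpos
  lift p' to ℝ≥0 using hp'
  lift p to ℝ≥0 using hp
  have a1 := ENNReal.toReal_mono (by finiteness) hpos
  have a2 := ENNReal.toReal_mono (by finiteness) hneg
  rw [ENNReal.toReal_add (by finiteness) (by finiteness), ENNReal.toReal_ofReal hc] at a1 a2
  simp only [ENNReal.coe_toReal] at a1 a2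
  have : (p' : ℝ) - m' ≤ p - m + 2 * c := by linarith
  change ((p' : ℝ) : EReal) - ((m' : ℝ) : EReal) ≤
    ((p : ℝ) : EReal) - ((m : ℝ) : EReal) + ((2 * c : ℝ) : EReal)
  exact_mod_cast this

lemma lintegral_div_rnDeriv_le {Ω : Type*} [MeasurableSpace Ω] (P ν : Measure Ω)
    [SigmaFinite P] [SigmaFinite ν] (hP : P ≪ ν) {g : Ω → ℝ≥0∞} (hg : Measurable g) :
    ∫⁻ ω, g ω / P.rnDeriv ν ω ∂P ≤ ∫⁻ ω, g ω ∂ν := by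
  have h := Measure.withDensity_rnDeriv_eq P ν hP
  calc ∫⁻ ω, g ω / P.rnDeriv ν ω ∂P
      = ∫⁻ ω, g ω / P.rnDeriv ν ω ∂(ν.withDensity (P.rnDeriv ν)) := by rw [h]
    _ ≤ _ := ?_
  rw [lintegral_withDensity_eq_lintegral_mul _ (Measure.measurable_rnDeriv _ _)
    (show Measurable fun ω => g ω / P.rnDeriv ν ω from hg.div (Measure.measurable_rnDeriv _ _))]
  refine lintegral_mono fun ω => ?_
  rw [Pi.mul_apply, mul_comm]
  exact ENNReal.mul_le_of_le_div le_rfl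

/-- **Gibbs' inequality** for extended real expectations. -/
lemma expectation_logRatio_nonneg {Ω : Type*} [MeasurableSpace Ω] (ρ ν : Measure Ω)
    [IsProbabilityMeasure ρ] [SigmaFinite ν] {r q : Ω → ℝ≥0} (hr : Measurable r)
    (hq : Measurable q) (hR : ρ = ν.withDensity fun ω => (r ω : ℝ≥0∞))
    (hq1 : ∫⁻ ω, (q ω : ℝ≥0∞) ∂ν = 1) :
    0 ≤ expectation ρ (fun ω => logRatio (r ω) (q ω)) := by
  have hac : ρ ≪ ν := hR ▸ withDensity_absolutelyContinuous _ _
  have hrR : ∀ᵐ ω ∂ρ, ρ.rnDeriv ν ω = r ω := by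
    refine hac.ae_le ?_
    rw [hR]
    exact Measure.rnDeriv_withDensity _ hr.coe_nnreal_ennreal
  have hr0 : ∀ᵐ ω ∂ρ, r ω ≠ 0 := by
    filter_upwards [Measure.rnDeriv_pos hac, hrR] with ω h1 h2 h3
    simp [h2, h3] at h1
  have hle : ∫⁻ ω, (q ω : ℝ≥0∞) / r ω ∂ρ ≤ 1 := by
    rw [← hq1]
    refine le_trans (le_of_eq (lintegral_congr_ae ?_))
      (lintegral_div_rnDeriv_le ρ ν hac hq.coe_nnreal_ennreal)
    filter_upwards [hrR] with ω h1
    rw [h1]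
  have hratio (ω) (h1 : r ω ≠ 0) (h2 : q ω ≠ 0) : (q ω : ℝ≥0∞) / r ω =
      ENNReal.ofReal (Real.exp (-(Real.log (r ω) - Real.log (q ω)))) := by
    have h1' : (0 : ℝ) < r ω := by exact_mod_cast pos_iff_ne_zero.2 h1
    have h2' : (0 : ℝ) < q ω := by exact_mod_cast pos_iff_ne_zero.2 h2
    rw [neg_sub, Real.exp_sub, Real.exp_log h1', Real.exp_log h2', ← ENNReal.coe_div h1,
      ← NNReal.coe_div, ENNReal.ofReal_coe_nnreal]
  have hm := measurable_logRatio hr hq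
  have hneg_le : lintegralNeg ρ (fun ω => logRatio (r ω) (q ω)) ≤ 1 := by
    refine le_trans (lintegral_mono_ae ?_) hle
    filter_upwards [hr0] with ω h1
    by_cases h2 : q ω = 0
    · simp [logRatio, h1, h2]
    rw [hratio ω h1 h2, logRatio_of_pos h1 h2, ← EReal.coe_neg, toENNReal_coe_real]
    refine ENNReal.ofReal_le_ofReal ?_
    linarith [Real.add_one_le_exp (-(Real.log (r ω) - Real.log (q ω)))]
  -- The integrated form of `1 - L ≤ e^{-L}`, with `L = log (r / q)` split into its two parts so
  -- that every term is nonnegative.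
  have hmain : lintegralNeg ρ (fun ω => logRatio (r ω) (q ω)) + 1 ≤
      lintegralPos ρ (fun ω => logRatio (r ω) (q ω)) + 1 := by
    calc lintegralNeg ρ (fun ω => logRatio (r ω) (q ω)) + 1
        = ∫⁻ ω, ((-logRatio (r ω) (q ω)).toENNReal + 1) ∂ρ := by
          rw [lintegral_add_right _ measurable_const]; simp [lintegralNeg]
      _ ≤ ∫⁻ ω, ((logRatio (r ω) (q ω)).toENNReal + (q ω : ℝ≥0∞) / r ω) ∂ρ := by
          refine lintegral_mono_ae ?_
          filter_upwards [hr0] with ω h1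
          by_cases h2 : q ω = 0
          · simp [logRatio, h1, h2]
          rw [hratio ω h1 h2, logRatio_of_pos h1 h2, ← EReal.coe_neg, toENNReal_coe_real,
            toENNReal_coe_real]
          set L := Real.log (r ω) - Real.log (q ω)
          have h3 := Real.add_one_le_exp (-L)
          rcases le_total 0 L with h | h
          · rw [ENNReal.ofReal_of_nonpos (p := -L) (by linarith), zero_add,
              ← ENNReal.ofReal_add h (by positivity), ← ENNReal.ofReal_one]
            exact ENNReal.ofReal_le_ofReal (by linarith)
          · rw [ENNReal.ofReal_of_nonpos h, zero_add, ← ENNReal.ofReal_one,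
              ← ENNReal.ofReal_add (by linarith) zero_le_one]
            exact ENNReal.ofReal_le_ofReal h3
      _ = lintegralPos ρ (fun ω => logRatio (r ω) (q ω)) + ∫⁻ ω, (q ω : ℝ≥0∞) / r ω ∂ρ := by
          rw [lintegral_add_left hm.ereal_toENNReal]; rfl
      _ ≤ _ := by gcongr
  have h := (ENNReal.add_le_add_iff_right ENNReal.one_ne_top).1 hmain
  unfold expectation
  refine (EReal.sub_nonneg ?_ ?_).2 (by exact_mod_cast h)
  · right; exact fun h => (ne_top_of_le_ne_top ENNReal.one_ne_top hneg_le) (by simpa using h)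
  · right; exact EReal.coe_ennreal_ne_bot _

lemma ae_llr_eq_sub {Ω : Type*} [MeasurableSpace Ω] {P Q ν : Measure Ω}
    [SigmaFinite P] [SigmaFinite Q] [SigmaFinite ν] (hPν : P ≪ ν) (hPQ : P ≪ Q) :
    ∀ᵐ ω ∂P, 0 < (Q.rnDeriv ν ω).toReal ∧ 0 < (P.rnDeriv ν ω).toReal ∧
      llr P Q ω = Real.log (P.rnDeriv ν ω).toReal - Real.log (Q.rnDeriv ν ω).toReal := by
  filter_upwards [hPν.ae_le (Measure.rnDeriv_mul_rnDeriv (κ := ν) hPQ), Measure.rnDeriv_pos hPν,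
    Measure.rnDeriv_pos hPQ, hPν.ae_le (Measure.rnDeriv_ne_top P ν),
    hPν.ae_le (Measure.rnDeriv_ne_top Q ν), hPQ.ae_le (Measure.rnDeriv_ne_top P Q)]
    with ω h1 h2 h3 h4 h5 h6
  rw [Pi.mul_apply] at h1
  have h7 : Q.rnDeriv ν ω ≠ 0 := fun h0 => by simp [h0] at h1; exact h2.ne h1
  have q0 := ENNReal.toReal_pos h7 h5
  have p0 := ENNReal.toReal_pos h2.ne' h4
  have l0 := ENNReal.toReal_pos h3.ne' h6
  refine ⟨q0, p0, ?_⟩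
  rw [← h1, ENNReal.toReal_mul, Real.log_mul l0.ne' q0.ne', llr]
  ring

/-- If `P` has finite divergence from `Q` and `q ≥ e^{-c} dQ/dν`, then for a probability density `r`
the expectation of `log (r / q)` under `P` is well defined and at most
`D(P ‖ Q) + c - D(P ‖ r ν)`. -/
lemma expectation_logRatio_le_of_klDiv {Ω : Type*} [MeasurableSpace Ω] (P Q R ν : Measure Ω)
    [IsProbabilityMeasure P] [IsProbabilityMeasure Q] [IsProbabilityMeasure R] [SigmaFinite ν]
    (hPν : P ≪ ν) {r q : Ω → ℝ≥0} (hr : Measurable r) (hq : Measurable q)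
    (hR : R = ν.withDensity fun ω => (r ω : ℝ≥0∞)) (hPQ : klDiv P Q ≠ ⊤) {c : ℝ}
    (hqQ : ∀ ω, Real.exp (-c) * (Q.rnDeriv ν ω).toReal ≤ q ω) :
    lintegralPos P (fun ω => logRatio (r ω) (q ω)) ≠ ⊤ ∧
      ∀ a : ℝ, ENNReal.ofReal a ≤ klDiv P R →
        expectation P (fun ω => logRatio (r ω) (q ω)) ≤
          (((klDiv P Q).toReal + c - a : ℝ) : EReal) := by
  obtain ⟨hac, hint⟩ := klDiv_ne_top_iff.1 hPQ
  have hRr : ∀ᵐ ω ∂P, R.rnDeriv ν ω = r ω := by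
    refine hPν.ae_le ?_
    rw [hR]
    exact Measure.rnDeriv_withDensity _ hr.coe_nnreal_ennreal
  have hllr := ae_llr_eq_sub hPν hac
  have hm := measurable_logRatio hr hq
  have hr1 : ∫⁻ ω, (r ω : ℝ≥0∞) ∂ν = 1 := by
    have := measure_univ (μ := R)
    rwa [hR, withDensity_apply _ MeasurableSet.univ, Measure.restrict_univ] at this
  -- The likelihood ratio `u` has `P`-integral at most one and dominates its own logarithm, so it
  -- serves as an integrable majorant of `log (r / p)`, where `p = dP/dν`.
  set u : Ω → ℝ := fun ω => r ω / (P.rnDeriv ν ω).toReal with hu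
  have hum : Measurable u := by fun_prop
  have hu0 (ω) : 0 ≤ u ω := by positivity
  have hule : ∫⁻ ω, ENNReal.ofReal (u ω) ∂P ≤ 1 := by
    rw [← hr1]
    refine le_trans (le_of_eq (lintegral_congr_ae ?_))
      (lintegral_div_rnDeriv_le P ν hPν hr.coe_nnreal_ennreal)
    filter_upwards [hllr, hPν.ae_le (Measure.rnDeriv_ne_top P ν)] with ω h1 h2
    rw [hu, ENNReal.ofReal_div_of_pos h1.2.1, ENNReal.ofReal_toReal h2, ENNReal.ofReal_coe_nnreal]
  have hui : Integrable u P := by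
    refine (lintegral_ofReal_ne_top_iff_integrable hum.aestronglyMeasurable
      (ae_of_all _ hu0)).1 (ne_top_of_le_ne_top ENNReal.one_ne_top hule)
  have hq0 : ∀ᵐ ω ∂P, q ω ≠ 0 := by
    filter_upwards [hllr] with ω h1 h2
    have h3 := hqQ ω
    rw [h2, NNReal.coe_zero] at h3
    have := mul_pos (Real.exp_pos (-c)) h1.1
    linarith
  have hlogq : ∀ᵐ ω ∂P, Real.log (P.rnDeriv ν ω).toReal - Real.log (q ω) ≤ llr P Q ω + c := by
    filter_upwards [hllr] with ω ⟨h1, h2, h3⟩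
    have := Real.log_le_log (by positivity) (hqQ ω)
    rw [Real.log_mul (by positivity) h1.ne', Real.log_exp] at this
    linarith
  have hlogu : ∀ᵐ ω ∂P, r ω ≠ 0 →
      Real.log (r ω) - Real.log (P.rnDeriv ν ω).toReal ≤ u ω := by
    filter_upwards [hllr] with ω ⟨_, h2, _⟩ h4
    have h4' : (0 : ℝ) < r ω := by exact_mod_cast pos_iff_ne_zero.2 h4
    rw [← Real.log_div h4'.ne' h2.ne']
    exact (Real.log_le_sub_one_of_pos (by positivity)).trans (by simp [hu])
  have hposfin : lintegralPos P (fun ω => logRatio (r ω) (q ω)) ≠ ⊤ := by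
    have hi : Integrable (fun ω => |llr P Q ω| + c + u ω) P :=
      (hint.abs.add (integrable_const c)).add hui
    refine ne_top_of_le_ne_top hi.lintegral_lt_top.ne (lintegral_mono_ae ?_)
    filter_upwards [hq0, hlogq, hlogu] with ω h1 h2 h3
    by_cases h4 : r ω = 0
    · simp [logRatio, h4, h1]
    rw [logRatio_of_pos h4 h1, toENNReal_coe_real]
    exact ENNReal.ofReal_le_ofReal (by linarith [h3 h4, le_abs_self (llr P Q ω)])
  refine ⟨hposfin, fun a ha => ?_⟩
  -- If the negative part is infinite, the expectation is `-∞`. Otherwise `log (r / q)` is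
  -- integrable, which forces `P ≪ R` and a finite `D(P ‖ R)`.
  by_cases hnegfin : lintegralNeg P (fun ω => logRatio (r ω) (q ω)) = ⊤
  · simp [expectation, hnegfin]
  have hr0 : ∀ᵐ ω ∂P, r ω ≠ 0 := by
    filter_upwards [ae_lt_top hm.neg.ereal_toENNReal hnegfin, hq0] with ω h1 h2 h3
    simp [logRatio, h2, h3] at h1
  set L : Ω → ℝ := fun ω => Real.log (r ω) - Real.log (q ω) with hL
  have hLm : Measurable L := by fun_prop
  have hLeq : ∀ᵐ ω ∂P, logRatio (r ω) (q ω) = (L ω : EReal) := by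
    filter_upwards [hr0, hq0] with ω h1 h2 using logRatio_of_pos h1 h2
  have hLpos : lintegralPos P (fun ω => logRatio (r ω) (q ω)) = ∫⁻ ω, ENNReal.ofReal (L ω) ∂P := by
    refine lintegral_congr_ae ?_
    filter_upwards [hLeq] with ω h
    rw [h, toENNReal_coe_real]
  have hLneg : lintegralNeg P (fun ω => logRatio (r ω) (q ω)) =
      ∫⁻ ω, ENNReal.ofReal (-L ω) ∂P := by
    refine lintegral_congr_ae ?_
    filter_upwards [hLeq] with ω h
    rw [h, ← EReal.coe_neg, toENNReal_coe_real]
  have hLi : Integrable L P := by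
    refine ⟨hLm.aestronglyMeasurable, ?_⟩
    rw [hasFiniteIntegral_iff_norm]
    refine lt_of_le_of_lt (lintegral_mono (g := fun ω => ENNReal.ofReal (L ω) +
      ENNReal.ofReal (-L ω)) fun ω => ?_) ?_
    · rcases le_total 0 (L ω) with h | h
      · simp [abs_of_nonneg h]
      · simp [abs_of_nonpos h]
    · rw [lintegral_add_left (by fun_prop), ← hLpos, ← hLneg]
      exact ENNReal.add_lt_top.2 ⟨hposfin.lt_top, Ne.lt_top hnegfin⟩
  have hexp : expectation P (fun ω => logRatio (r ω) (q ω)) = ((∫ ω, L ω ∂P : ℝ) : EReal) := by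
    rw [integral_eq_lintegral_pos_part_sub_lintegral_neg_part hLi, ← hLpos, ← hLneg, EReal.coe_sub,
      EReal.coe_ennreal_toReal hposfin, EReal.coe_ennreal_toReal hnegfin, expectation]
  have hPR : P ≪ R := by
    refine Measure.AbsolutelyContinuous.mk fun s hs h => ?_
    rw [hR, withDensity_apply _ hs, lintegral_eq_zero_iff hr.coe_nnreal_ennreal] at h
    have h' := (ae_restrict_iff' hs).1 h
    rw [measure_eq_zero_iff_ae_notMem]
    filter_upwards [hPν.ae_le h', hr0] with ω h1 h2 h3
    exact h2 (by simpa using h1 h3)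
  have hllrR : ∀ᵐ ω ∂P, llr P R ω = Real.log (P.rnDeriv ν ω).toReal - Real.log (r ω) := by
    filter_upwards [ae_llr_eq_sub hPν hPR, hRr] with ω h1 h2
    rw [h1.2.2, h2, ENNReal.coe_toReal]
  have hup : ∀ᵐ ω ∂P, llr P R ω ≤ llr P Q ω + c - L ω := by
    filter_upwards [hllrR, hlogq] with ω h1 h2
    rw [h1]
    simp only [hL]
    linarith
  have hupi : Integrable (fun ω => llr P Q ω + c - L ω) P :=
    (hint.add (integrable_const c)).sub hLi
  -- The log-likelihood ratio lies between `-u` and the integrable upper bound from `hup`.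
  have hRi : Integrable (llr P R) P := by
    refine (hupi.abs.add hui).mono' (measurable_llr _ _).aestronglyMeasurable ?_
    filter_upwards [hup, hllrR, hlogu, hr0] with ω h1 h2 h3 h4
    rw [Real.norm_eq_abs, abs_le, Pi.add_apply]
    have := le_abs_self (llr P Q ω + c - L ω)
    have := abs_nonneg (llr P Q ω + c - L ω)
    have := hu0 ω
    have := h3 h4
    constructor <;> linarith
  have hint_le := integral_mono_ae hRi hupi hup
  have e0 : ∫ ω, (llr P Q ω + c - L ω) ∂P = ∫ ω, llr P Q ω ∂P + c - ∫ ω, L ω ∂P := by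
    rw [integral_sub (f := fun ω => llr P Q ω + c) (hint.add (integrable_const c)) hLi,
      integral_add hint (integrable_const c)]
    simp
  rw [e0] at hint_le
  have e1 := toReal_klDiv_of_measure_eq hPR (by simp)
  have e2 := toReal_klDiv_of_measure_eq hac (by simp)
  rw [hexp, EReal.coe_le_coe_iff]
  have ha' : a ≤ (klDiv P R).toReal :=
    (ENNReal.ofReal_le_iff_le_toReal (klDiv_ne_top hPR hRi)).1 ha
  linarith

/-! ### The mixture density and the comparison of regrets -/

lemma exists_mixture_density {Ω : Type*} [MeasurableSpace Ω] (ν : Measure Ω) (Q : Measure Ω)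
    [IsProbabilityMeasure Q] [SigmaFinite ν] {q : Ω → ℝ≥0} (hq : Measurable q)
    (hq1 : ∫⁻ ω, (q ω : ℝ≥0∞) ∂ν = 1) {c : ℝ} (hc : 0 ≤ c) :
    ∃ q' : Ω → ℝ≥0, Measurable q' ∧ ∫⁻ ω, (q' ω : ℝ≥0∞) ∂ν = 1 ∧
      (∀ ω, (1 - Real.exp (-c)) * q ω ≤ q' ω) ∧
      ∀ ω, Real.exp (-c) * (Q.rnDeriv ν ω).toReal ≤ q' ω := by
  set Λ : ℝ≥0 := ⟨Real.exp (-c), (Real.exp_pos _).le⟩ with hΛ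
  have hΛ1 : Λ ≤ 1 := by
    rw [← NNReal.coe_le_coe]
    change Real.exp (-c) ≤ 1
    simpa using hc
  have hgm : Measurable fun ω => (Q.rnDeriv ν ω).toNNReal :=
    (Measure.measurable_rnDeriv Q ν).ennreal_toNNReal
  have hg1 : ∫⁻ ω, ((Q.rnDeriv ν ω).toNNReal : ℝ≥0∞) ∂ν ≤ 1 := by
    refine (lintegral_mono fun ω => ENNReal.coe_toNNReal_le_self).trans ?_
    simpa using Measure.lintegral_rnDeriv_le (μ := Q) (ν := ν)
  obtain ⟨m, hm⟩ : ∃ m : ℝ≥0, (m : ℝ≥0∞) = ∫⁻ ω, ((Q.rnDeriv ν ω).toNNReal : ℝ≥0∞) ∂ν :=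
    ⟨_, ENNReal.coe_toNNReal (ne_top_of_le_ne_top ENNReal.one_ne_top hg1)⟩
  have hm1 : m ≤ 1 := by rw [← hm] at hg1; exact_mod_cast hg1
  have hΛm : Λ * m ≤ 1 := mul_le_one' hΛ1 hm1
  -- `Q` may have a part singular to `ν`, so its density has mass `m ≤ 1`; the weight `1 - Λ * m` on
  -- `q` restores total mass one.
  refine ⟨fun ω => (1 - Λ * m) * q ω + Λ * (Q.rnDeriv ν ω).toNNReal, by fun_prop, ?_, ?_, ?_⟩
  · push_cast
    rw [lintegral_add_left (by fun_prop), lintegral_const_mul _ (by fun_prop),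
      lintegral_const_mul _ (by fun_prop), hq1, ← hm, mul_one]
    have := tsub_add_cancel_of_le hΛm
    exact_mod_cast this
  · intro ω
    rw [NNReal.coe_add, NNReal.coe_mul, NNReal.coe_mul, NNReal.coe_sub hΛm, NNReal.coe_mul,
      NNReal.coe_one]
    have h1 : (Λ : ℝ) * m ≤ Real.exp (-c) :=
      mul_le_of_le_one_right (Real.exp_pos _).le (by exact_mod_cast hm1)
    have h2 : (0 : ℝ) ≤ Λ * (Q.rnDeriv ν ω).toNNReal := by positivity
    nlinarith [mul_le_mul_of_nonneg_right h1 (q ω).coe_nonneg]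
  · intro ω
    push_cast
    have h2 : (0 : ℝ) ≤ ((1 - Λ * m : ℝ≥0) : ℝ) * q ω := by positivity
    exact le_add_of_nonneg_left h2

section

variable {Y : Type*} [MeasurableSpace Y] {μ : Measure Y} [SigmaFinite μ] {Θ : Type*}
  {f : Θ → Y → ℝ≥0} {Pm : Θ → ProbabilityMeasure Y} {Φ : Set (ProbabilityMeasure Y)}

lemma iidPower_eq_withDensity (hf : ∀ θ, Measurable (f θ))
    (hPm : ∀ θ, (Pm θ : Measure Y) = μ.withDensity fun y => (f θ y : ℝ≥0∞)) (n : ℕ) (θ : Θ) :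
    (iidPower n (Pm θ) : Measure (Fin n → Y)) =
      (Measure.pi fun _ : Fin n => μ).withDensity
        fun y => ((∏ t, f θ (y t) : ℝ≥0) : ℝ≥0∞) := by
  have : SigmaFinite (μ.withDensity fun y => (f θ y : ℝ≥0∞)) := by rw [← hPm]; infer_instance
  rw [iidPower, ProbabilityMeasure.toMeasure_pi, hPm,
    pi_withDensity n μ _ (hf θ).coe_nnreal_ennreal]
  simp only [ENNReal.ofNNReal_finsetProd]

lemma mem_enlargedModel (hΘΦ : ∀ θ, Pm θ ∈ Φ) (ε : ℝ) (θ : Θ) : Pm θ ∈ enlargedModel Pm Φ ε :=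
  ⟨hΘΦ θ, (iInf_le _ θ).trans (by simp)⟩

lemma regret_le_regret_enlargedModel_add (hf : ∀ θ, Measurable (f θ))
    (hPm : ∀ θ, (Pm θ : Measure Y) = μ.withDensity fun y => (f θ y : ℝ≥0∞))
    (hΘΦ : ∀ θ, Pm θ ∈ Φ) (hΦμ : ∀ P ∈ Φ, (P : Measure Y) ≪ μ) (θ₀ : Θ) (n : ℕ)
    (Q : ProbabilityMeasure (Fin n → Y)) {K : ℝ} (hK : 0 ≤ K)
    (hQ : ∀ P ∈ Φ, klDiv (iidPower n P : Measure (Fin n → Y)) Q ≤ ENNReal.ofReal K)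
    {ε c δ : ℝ} (hc : 0 < c)
    (hδ₁ : 2 * (-Real.log (1 - Real.exp (-c))) ≤ δ) (hδ₂ : K + c - n * ε ≤ δ) :
    regret f μ n (iidClass n Φ) ≤
      regret f μ n (iidClass n (enlargedModel Pm Φ ε)) + (δ : EReal) := by
  have he1 : Real.exp (-c) < 1 := by simpa using hc
  have he0 := Real.exp_pos (-c)
  set d := -Real.log (1 - Real.exp (-c)) with hd
  have hd0 : 0 ≤ d := neg_nonneg.2 (Real.log_nonpos (by linarith) (by linarith))
  have hexpd : Real.exp (-d) = 1 - Real.exp (-c) := by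
    rw [hd, neg_neg, Real.exp_log (by linarith)]
  -- Moving `δ` to the left leaves a bare infimum on the right, so each admissible `q` can be
  -- treated separately.
  refine (EReal.sub_le_iff_le_add (Or.inl (EReal.coe_ne_bot _)) (Or.inl (EReal.coe_ne_top _))).1 ?_
  refine le_iInf₂ fun q hq => ?_
  refine (EReal.sub_le_iff_le_add (Or.inl (EReal.coe_ne_bot _)) (Or.inl (EReal.coe_ne_top _))).2 ?_
  set ν := Measure.pi fun _ : Fin n => μ with hν
  obtain ⟨q', hq'm, hq'1, hq'q, hq'Q⟩ :=
    exists_mixture_density ν (Q : Measure (Fin n → Y)) hq.measurable hq.lintegral_eq_one hc.le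
  have hprod (θ) : Measurable fun y : Fin n → Y => ∏ t, f θ (y t) :=
    Finset.measurable_fun_prod _ fun i _ => (hf θ).comp (measurable_pi_apply i)
  have hbound (P) (hP : P ∈ Φ) (θ : Θ) :=
    expectation_logRatio_le_of_klDiv (iidPower n P : Measure (Fin n → Y)) Q (iidPower n (Pm θ)) ν
      (pi_absolutelyContinuous n (hΦμ P hP)) (hprod θ) hq'm (iidPower_eq_withDensity hf hPm n θ)
      (ne_top_of_le_ne_top ENNReal.ofReal_ne_top (hQ P hP)) hq'Q
  -- Admissibility is needed on all of `Φ`, where `q` may fail it; finiteness of `D(P^n ‖ Q)` makes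
  -- the positive parts finite.
  have hadm : Admissible f μ n (iidClass n Φ) q' := by
    refine ⟨hq'm, hq'1, ?_⟩
    rintro _ ⟨P, hP, rfl⟩ θ
    exact Or.inl (hbound P hP θ).1
  set S := ⨆ P ∈ iidClass n (enlargedModel Pm Φ ε), ⨆ θ : Θ,
    expectation (P : Measure (Fin n → Y)) (logLikelihoodRatio f n q θ) with hS
  have hSle (P) (hP : P ∈ enlargedModel Pm Φ ε) (θ : Θ) :
      expectation (iidPower n P : Measure (Fin n → Y)) (logLikelihoodRatio f n q θ) ≤ S :=
    (le_iSup (fun θ => expectation (iidPower n P : Measure (Fin n → Y))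
      (logLikelihoodRatio f n q θ)) θ).trans
      (le_iSup₂ (f := fun (P : ProbabilityMeasure (Fin n → Y))
        (_ : P ∈ iidClass n (enlargedModel Pm Φ ε)) => ⨆ θ : Θ,
          expectation (P : Measure (Fin n → Y)) (logLikelihoodRatio f n q θ))
        (iidPower n P) ⟨P, hP, rfl⟩)
  have hS0 : 0 ≤ S :=
    (expectation_logRatio_nonneg (iidPower n (Pm θ₀) : Measure (Fin n → Y)) ν (hprod θ₀)
      hq.measurable (iidPower_eq_withDensity hf hPm n θ₀) hq.lintegral_eq_one).trans
      (hSle _ (mem_enlargedModel hΘΦ ε θ₀) θ₀)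
  refine iInf₂_le_of_le q' hadm (iSup₂_le ?_)
  rintro _ ⟨P, hP, rfl⟩
  refine iSup_le fun θ => ?_
  by_cases hPε : P ∈ enlargedModel Pm Φ ε
  · refine (expectation_logRatio_le_add (iidPower n P : Measure (Fin n → Y)) (fun y => ∏ t, f θ (y t)) q q' hd0
      (fun ω => by rw [hexpd]; exact hq'q ω)).trans ?_
    exact add_le_add (hSle P hPε θ) (EReal.coe_le_coe_iff.2 hδ₁)
  · have h1 : ENNReal.ofReal ε ≤ klDiv (P : Measure Y) (Pm θ) := by
      have h2 : ¬ divergenceToModel Pm P ≤ ENNReal.ofReal ε := fun h => hPε ⟨hP, h⟩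
      exact (not_le.1 h2).le.trans (iInf_le _ θ)
    have h3 : ENNReal.ofReal (n * ε) ≤
        klDiv (iidPower n P : Measure (Fin n → Y)) (iidPower n (Pm θ) : Measure (Fin n → Y)) := by
      rw [ENNReal.ofReal_mul (Nat.cast_nonneg n), ENNReal.ofReal_natCast]
      exact (mul_le_mul_right h1 _).trans (nsmul_klDiv_le_klDiv_pi (P : Measure Y) (Pm θ) n)
    have h4 := (hbound P hP θ).2 _ h3
    have h5 := ENNReal.toReal_le_of_le_ofReal hK (hQ P hP)
    calc expectation (iidPower n P : Measure (Fin n → Y)) (logLikelihoodRatio f n q' θ)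
        ≤ _ := h4
      _ ≤ (δ : EReal) := EReal.coe_le_coe_iff.2 (by linarith)
      _ = 0 + (δ : EReal) := (zero_add _).symm
      _ ≤ S + (δ : EReal) := add_le_add hS0 le_rfl

end

end MisspecifiedRegret

/-! ### Choice of the mixing weights -/

open MisspecifiedRegret InformationTheory

theorem theorem3 {Y : Type*} [MeasurableSpace Y] (μ : Measure Y) [SigmaFinite μ]
    {Θ : Type*} (f : Θ → Y → ℝ≥0) (hf : ∀ θ, Measurable (f θ))
    (Pm : Θ → ProbabilityMeasure Y)
    (hPm : ∀ θ, (Pm θ : Measure Y) = μ.withDensity fun y => (f θ y : ℝ≥0∞))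
    (Φ : Set (ProbabilityMeasure Y)) (hΘΦ : ∀ θ, Pm θ ∈ Φ)
    (hΦμ : ∀ P ∈ Φ, (P : Measure Y) ≪ μ)
    (τ : ℕ → ℝ)
    (hcap : ∀ n : ℕ, 1 ≤ n →
      (MisspecifiedRegret.capacity Φ n : EReal) = ((τ n * (n : ℝ) : ℝ) : EReal))
    (hτ : Tendsto τ atTop (𝓝 0))
    (ε : ℕ → ℝ) (hε : ∀ n, 0 < ε n) (hετ : τ =o[atTop] ε) :
    ∃ δ : ℕ → ℝ, Tendsto δ atTop (𝓝 0) ∧ ∀ n : ℕ, 1 ≤ n →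
      MisspecifiedRegret.regret f μ n (MisspecifiedRegret.iidClass n Φ) ≤
        MisspecifiedRegret.regret f μ n
          (MisspecifiedRegret.iidClass n (MisspecifiedRegret.enlargedModel Pm Φ (ε n))) +
        ((δ n : ℝ) : EReal) := by
  rcases isEmpty_or_nonempty Θ with hΘ | ⟨⟨θ₀⟩⟩
  · refine ⟨0, tendsto_const_nhds, fun n _ => ?_⟩
    have h (A B : Set (ProbabilityMeasure (Fin n → Y))) (q : (Fin n → Y) → ℝ≥0)
        (hq : Admissible f μ n A q) : Admissible f μ n B q :=
      ⟨hq.measurable, hq.lintegral_eq_one, fun _ _ θ => hΘ.elim θ⟩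
    simp only [Pi.zero_apply, EReal.coe_zero, add_zero]
    refine le_iInf₂ fun q hq => iInf₂_le_of_le q (h _ _ q hq) ?_
    simp
  by_cases hsub : ∃ P ∈ Φ, P ≠ Pm θ₀
  swap
  · push Not at hsub
    refine ⟨0, tendsto_const_nhds, fun n _ => ?_⟩
    have : enlargedModel Pm Φ (ε n) = Φ :=
      Set.Subset.antisymm (fun P hP => hP.1)
        fun P hP => hsub P hP ▸ mem_enlargedModel hΘΦ (ε n) θ₀
    simp [this]
  obtain ⟨P₁, hP₁, hne⟩ := hsub
  obtain ⟨c₀, hc₀, hcap₀⟩ := exists_pos_le_capacity hP₁ (hΘΦ θ₀) hne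
  have hcap' (n : ℕ) (hn : 1 ≤ n) : capacity Φ n ≠ ⊤ := fun h => by
    have := hcap n hn
    rw [h, EReal.coe_ennreal_top] at this
    exact EReal.coe_ne_top _ this.symm
  have hcapR (n : ℕ) (hn : 1 ≤ n) : (capacity Φ n).toReal = τ n * n := by
    have := hcap n hn
    rw [← EReal.coe_ennreal_toReal (hcap' n hn)] at this
    exact_mod_cast this
  have hτpos (n : ℕ) (hn : 1 ≤ n) : c₀ ≤ τ n * n := by
    rw [← hcapR n hn]
    exact (ENNReal.ofReal_le_iff_le_toReal (hcap' n hn)).1 (hcap₀ n hn)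
  have hgrow : Tendsto (fun n : ℕ => n * (ε n - τ n) - 1) atTop atTop := by
    rw [tendsto_atTop]
    intro b
    -- Once `ε n ≥ M * τ n`, the gap `n * (ε n - τ n)` is at least `(M - 1) * c₀ = |b| + 1`.
    set M : ℝ := (|b| + 1) / c₀ + 1 with hM
    have hM0 : 0 < M := by positivity
    filter_upwards [hετ.bound (inv_pos.2 hM0), eventually_ge_atTop 1] with n h1 hn
    have h2 := hτpos n hn
    have hn' : (0 : ℝ) < n := by exact_mod_cast hn
    have hτ0 : 0 < τ n := by
      by_contra! h
      nlinarith
    rw [Real.norm_of_nonneg hτ0.le, Real.norm_of_nonneg (hε n).le, inv_mul_eq_div,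
      le_div_iff₀ hM0] at h1
    have h3 : (|b| + 1) / c₀ * c₀ ≤ (M - 1) * (τ n * n) := by
      rw [hM, add_sub_cancel_right]
      gcongr
    rw [div_mul_cancel₀ _ hc₀.ne'] at h3
    nlinarith [le_abs_self b, mul_le_mul_of_nonneg_left h1 hn'.le]
  -- The second entry is the `c` solving `K + c = n * ε n` with `K = τ n * n + 1`. The maximum keeps
  -- `c` positive for small `n`; for large `n` the far-regime error is exactly zero.
  set x : ℕ → ℝ := fun n => max 1 (n * (ε n - τ n) - 1) with hx
  have hx0 (n) : 0 < x n := lt_of_lt_of_le one_pos (le_max_left _ _)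
  have hxtop : Tendsto x atTop atTop := tendsto_atTop_mono (fun n => le_max_right _ _) hgrow
  refine ⟨fun n => max (2 * (-Real.log (1 - Real.exp (-x n)))) (τ n * n + 1 + x n - n * ε n),
    ?_, fun n hn => ?_⟩
  · have h1 : Tendsto (fun n => 2 * (-Real.log (1 - Real.exp (-x n)))) atTop (𝓝 0) := by
      have h2 : Tendsto (fun n => 1 - Real.exp (-x n)) atTop (𝓝 (1 - 0)) :=
        tendsto_const_nhds.sub (Real.tendsto_exp_neg_atTop_nhds_zero.comp hxtop)
      have h3 := ((Real.continuousAt_log (by norm_num : (1 - 0 : ℝ) ≠ 0)).tendsto.comp h2).neg.const_mul 2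
      simpa using h3
    refine h1.congr' ?_
    filter_upwards [hgrow.eventually_ge_atTop 1] with n hn
    refine (max_eq_left ?_).symm
    have h4 : x n = n * (ε n - τ n) - 1 := max_eq_right hn
    have h5 : Real.log (1 - Real.exp (-x n)) ≤ 0 :=
      Real.log_nonpos (by simpa using (hx0 n).le) (by linarith [Real.exp_pos (-x n)])
    rw [h4] at h5 ⊢
    linarith
  · have hlt : capacity Φ n < ENNReal.ofReal (τ n * n + 1) := by
      rw [← hcapR n hn, ← ENNReal.ofReal_toReal (hcap' n hn), ENNReal.toReal_ofReal (by simp)]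
      exact (ENNReal.ofReal_lt_ofReal_iff (by positivity)).2 (by linarith)
    obtain ⟨Q, hQ⟩ := iInf_lt_iff.1 hlt
    refine regret_le_regret_enlargedModel_add hf hPm hΘΦ hΦμ θ₀ n Q
      (by linarith [hτpos n hn] : 0 ≤ τ n * n + 1) (fun P hP => ?_) (hx0 n)
      (le_max_left _ _) (le_max_right _ _)
    exact (le_iSup₂ (f := fun (P : ProbabilityMeasure Y) (_ : P ∈ Φ) =>
      klDiv (iidPower n P : Measure (Fin n → Y)) (Q : Measure (Fin n → Y))) P hP).trans hQ.le
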